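/- Let $(V,\langle\cdot,\cdot\rangle)$ be a Euclidean Jordan algebra, that is, a finite-dimensional real inner product space with a bilinear product $\bullet$ and a unit $e$ such that, for all $x,y,z\in V$, $x\bullet y=y\bullet x$, $x\bullet(x^2\bullet y)=x^2\bullet(x\bullet y)$ (where $x^2=x\bullet x$) and $\langle x\bullet y,z\rangle=\langle y,x\bullet z\rangle$. Let $K=\{v^2: v\in V\}$ be its cone of squares and $K^\circ$ the interior of $K$, the symmetric cone of $V$. Write $x\le_K y$ if $y-x\in K$, and for $x,y\in K^\circ$ let $$M(x/y)=\inf\{\beta>0: x\le_K\beta y\},\qquad d_K(x,y)=\log\max\{M(x/y),M(y/x)\}$$ (Thompson's metric). A geodesic segment connecting $x$ and $y$ in $(K^\circ,d_K)$ is the image of a map $\gamma\colon[a,b]\to K^\circ$ with $\gamma(a)=x$, $\gamma(b)=y$ and $d_K(\gamma(s),\gamma(t))=|s-t|$ for all $s,t\in[a,b]$. Each $z\in V$ can be written, uniquely up to order, as $z=\lambda_1c_1+\cdots+\lambda_kc_k$ with distinct real numbers $\lambda_i$ and nonzero elements $c_i$ satisfying $c_i^2=c_i$, $c_i\bullet c_j=0$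 for $i\ne j$, and $c_1+\cdots+c_k=e$; put $\sigma(z)=\{\lambda_1,\dots,\lambda_k\}$ and, for $z\in K^\circ$ (where all $\lambda_i>0$), $z^{-1/2}=\lambda_1^{-1/2}c_1+\cdots+\lambda_k^{-1/2}c_k$. For $u\in V$ let $P(u)z=2\,u\bullet(u\bullet z)-u^2\bullet z$ be the quadratic representation. **Theorem.** If $x,y\in K^\circ$ are linearly independent, then there exists a unique geodesic segment connecting $x$ and $y$ in $(K^\circ,d_K)$ if and only if $\sigma(P(y^{-1/2})x)=\{\beta^{-1},\beta\}$ for some $\beta>1$. -/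

import Mathlib

open scoped ENNReal

noncomputable section

/-! ### The order of a cone and Thompson's metric -/

section Thompson

variable {V : Type*} [AddCommGroup V] [Module ℝ V]

/-- The relation `x ≤_C y`, that is, `y - x ∈ C`. -/
def ConeLE (C : Set V) (x y : V) : Prop := y - x ∈ C

/-- `y` dominates `x` if `x ≤_C β y` for some `β > 0`. -/
def ConeDominates (C : Set V) (y x : V) : Prop :=
  ∃ β : ℝ, 0 < β ∧ ConeLE C x (β • y)

/-- The relation `x ∼_C y`: each of `x`, `y` dominates the other. -/
def ConeEquiv (C : Set V) (x y : V) : Prop :=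
  ConeDominates C y x ∧ ConeDominates C x y

/-- `M(x/y; C) = inf {β > 0 : x ≤_C β y}`. -/
def coneM (C : Set V) (x y : V) : ℝ :=
  sInf {β : ℝ | 0 < β ∧ ConeLE C x (β • y)}

open Classical in
/-- Thompson's metric `d_C`, with values in `[0, ∞]`. -/
def thompsonDist (C : Set V) (x y : V) : ℝ≥0∞ :=
  if ConeEquiv C x y then
    ENNReal.ofReal (Real.log (max (coneM C x y) (coneM C y x)))
  else ⊤

end Thompson

/-! ### Geodesic segments -/

section Geodesic

variable {V : Type*}

/-- `γ` restricted to `[a, b]` is a geodesic path in `(X, d)`. -/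
def IsGeodesicPathOn (d : V → V → ℝ≥0∞) (X : Set V) (a b : ℝ) (γ : ℝ → V) : Prop :=
  (∀ t ∈ Set.Icc a b, γ t ∈ X) ∧
    ∀ s ∈ Set.Icc a b, ∀ t ∈ Set.Icc a b, d (γ s) (γ t) = ENNReal.ofReal |s - t|

/-- `S` is a geodesic segment in `(X, d)` connecting `x` and `y`: the image of a geodesic path
`[a, b] → X` that starts at `x` and ends at `y`. -/
def IsGeodesicSegment (d : V → V → ℝ≥0∞) (X : Set V) (x y : V) (S : Set V) : Prop :=
  ∃ (a b : ℝ) (γ : ℝ → V), a ≤ b ∧ IsGeodesicPathOn d X a b γ ∧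
    γ a = x ∧ γ b = y ∧ S = γ '' Set.Icc a b

end Geodesic

/-! ### Euclidean Jordan algebras -/

/-- The structure of a Euclidean Jordan algebra, with unit `e`, on a real inner product space
(finite-dimensionality is imposed separately). -/
structure EuclideanJordanAlgebra (V : Type*) [NormedAddCommGroup V] [InnerProductSpace ℝ V] where
  /-- The bilinear product `(x, y) ↦ x • y`; thus `L x` is the multiplication operator by `x`. -/
  L : V →ₗ[ℝ] V →ₗ[ℝ] V
  /-- The unit. -/
  e : V
  mul_comm : ∀ x y : V, L x y = L y x
  jordan : ∀ x y : V, L x (L (L x x) y) = L (L x x) (L x y)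
  selfAdjoint : ∀ x y z : V, inner ℝ (L x y) z = inner ℝ y (L x z)
  unit_mul : ∀ x : V, L e x = x

namespace EuclideanJordanAlgebra

variable {V : Type*} [NormedAddCommGroup V] [InnerProductSpace ℝ V]
  (J : EuclideanJordanAlgebra V)

/-- The cone of squares `K`. -/
def coneOfSquares : Set V := {x | ∃ v : V, x = J.L v v}

/-- The symmetric cone `K°` of the algebra: the interior of the cone of squares. -/
def symmetricCone : Set V := interior J.coneOfSquares

/-- The quadratic representation `P(x) = 2 L(x)² - L(x²)`. -/
def P (x : V) : V →ₗ[ℝ] V :=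
  (2 : ℝ) • (J.L x ∘ₗ J.L x) - J.L (J.L x x)

/-- A spectral decomposition `x = λ₁ c₁ + ⋯ + λₖ cₖ`, with distinct real `λᵢ` and a complete
system of nonzero orthogonal idempotents `cᵢ`. -/
structure SpectralDecomposition (x : V) where
  k : ℕ
  eig : Fin k → ℝ
  c : Fin k → V
  eig_injective : Function.Injective eig
  c_ne_zero : ∀ i, c i ≠ 0
  idempotent : ∀ i, J.L (c i) (c i) = c i
  orthogonal : ∀ i j, i ≠ j → J.L (c i) (c j) = 0
  complete : ∑ i, c i = J.e
  decomp : x = ∑ i, eig i • c i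

/-- The spectrum `σ(x)`: the set of the eigenvalues of `x`. -/
def spec (x : V) : Set ℝ :=
  {t | ∃ D : J.SpectralDecomposition x, t ∈ Set.range D.eig}

open Classical in
/-- The spectral calculus `f(x) = f(λ₁) c₁ + ⋯ + f(λₖ) cₖ`. In a finite-dimensional algebra a
spectral decomposition of `x` exists and is unique up to order, so the choice is immaterial and
the second branch does not occur. -/
def functionalCalculus (f : ℝ → ℝ) (x : V) : V :=
  if h : Nonempty (J.SpectralDecomposition x) then
    ∑ i, f (h.some.eig i) • h.some.c i
  else 0

/-- `x^{-1/2}`, for `x` in the symmetric cone. -/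
def invSqrt (x : V) : V := J.functionalCalculus (fun t => t ^ (-(1 / 2) : ℝ)) x

end EuclideanJordanAlgebra

end

/-! The map `P(y^{-1/2})` is a linear automorphism of `K` sending `y` to `e`, hence a Thompson
isometry, so it suffices to join `z = ∑ exp(lᵢ) cᵢ`, not a multiple of `e`, to `e`.

On the span of the `cᵢ` the metric is the sup metric of the logarithms (`thompsonDist_exp`). With `r
= max |lᵢ|`, the largest and the smallest 1-Lipschitz coordinate paths from `lᵢ` to `0` on `[0, r]`
both give geodesics. If their images coincide, then `|lᵢ| = r` for all `i`
(`abs_eq_of_upper_eq_lower`), and both signs occur because `z` is not a multiple of `e`.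

Conversely, suppose `|lᵢ| = r` for all `i`, and let `w` be any point of a geodesic, possibly outside
that span. The order inequalities expressing its distances to `z` and `e`, paired with `cᵢ`, become
equalities. A cone element orthogonal to an idempotent has zero product with it, so `w • cᵢ` is a
prescribed multiple of `cᵢ`, and summing over `i` determines `w` (`eq_of_coneLE`).

The algebra underneath is the spectral theorem, the description of `K` by positivity of `L x`
(`mem_coneOfSquares_iff_inner`), and the invariance of `K` under `P` of positive elements
(`P_mem_coneOfSquares`). -/

namespace EuclideanJordanAlgebra

variable {V : Type*} [NormedAddCommGroup V] [InnerProductSpace ℝ V]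
  (J : EuclideanJordanAlgebra V)

/-! ### Linearized Jordan identity; positivity of idempotents. -/

/-- The full linearization of the Jordan identity. -/
theorem linearized_jordan (x y z w : V) :
    J.L x (J.L (J.L y z) w) + J.L y (J.L (J.L z x) w) + J.L z (J.L (J.L x y) w) =
      J.L (J.L y z) (J.L x w) + J.L (J.L z x) (J.L y w) + J.L (J.L x y) (J.L z w) := by
  have hx := J.jordan x w
  have hy := J.jordan y w
  have hz := J.jordan z w
  have hxy := J.jordan (x + y) w
  have hyz := J.jordan (y + z) w
  have hxz := J.jordan (x + z) w
  have hxyz := J.jordan (x + y + z) w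
  simp only [map_add, LinearMap.add_apply, J.mul_comm z y, J.mul_comm y x, J.mul_comm x z] at *
  -- Inclusion-exclusion isolates the part trilinear in `x`, `y`, `z`, where each term occurs twice.
  linear_combination (norm := module) (1 / 2 : ℝ) • (hxyz - hxy - hyz - hxz + hx + hy + hz)

/-- The linearized Jordan identity, read as an identity between multiplication operators. -/
theorem linearized_jordan_operator (x y w z : V) :
    J.L x (J.L w (J.L y z)) + J.L y (J.L w (J.L x z)) + J.L (J.L (J.L x y) w) z =
      J.L (J.L x w) (J.L y z) + J.L (J.L y w) (J.L x z) + J.L (J.L x y) (J.L w z) := by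
  have h := J.linearized_jordan x y z w
  rw [J.mul_comm w (J.L y z), J.mul_comm w (J.L x z), J.mul_comm (J.L (J.L x y) w) z,
    J.mul_comm (J.L x w), J.mul_comm (J.L y w), J.mul_comm w z, J.mul_comm x z]
  exact h

theorem mul_unit (x : V) : J.L x J.e = x := by rw [J.mul_comm, J.unit_mul]

theorem isSymmetric_L (x : V) : (J.L x).IsSymmetric := fun y z => J.selfAdjoint x y z

theorem inner_mul_self (x v : V) : inner ℝ (J.L x v) v = inner ℝ x (J.L v v) := by
  rw [J.mul_comm, J.selfAdjoint]

section Idempotents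

variable {J} {c d : V}

/-- This confines the eigenvalues of `L c` to the Peirce values `0`, `1/2`, `1`. -/
theorem idempotent_cubic (hc : J.L c c = c) (v : V) :
    (2 : ℝ) • J.L c (J.L c (J.L c v)) - (3 : ℝ) • J.L c (J.L c v) + J.L c v = 0 := by
  have h := J.linearized_jordan_operator c c c v
  simp only [hc] at h
  linear_combination (norm := module) h

/-- Multiplication by an idempotent is a positive semidefinite operator. -/
theorem idempotent_inner_nonneg (hc : J.L c c = c) (v : V) : 0 ≤ inner ℝ (J.L c v) v := by
  -- The coefficients come from `λ = λ² + 4 (λ - λ²)²`, valid at `λ = 0, 1/2, 1`.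
  have key : inner ℝ (J.L c v) v = ‖J.L c v‖ ^ 2 + 4 * ‖J.L c v - J.L c (J.L c v)‖ ^ 2 := by
    have h1 := idempotent_cubic hc v
    have h2 : J.L c (J.L c (J.L c v)) =
        (3 / 2 : ℝ) • J.L c (J.L c v) - (1 / 2 : ℝ) • J.L c v := by
      linear_combination (norm := module) (1 / 2 : ℝ) • h1
    have e1 : inner ℝ (J.L c v) (J.L c v) = inner ℝ v (J.L c (J.L c v)) := J.selfAdjoint _ _ _
    have e2 : inner ℝ (J.L c v) (J.L c (J.L c v)) =
        inner ℝ v (J.L c (J.L c (J.L c v))) := J.selfAdjoint _ _ _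
    have e3 : inner ℝ (J.L c (J.L c v)) (J.L c (J.L c v)) =
        inner ℝ (J.L c v) (J.L c (J.L c (J.L c v))) := J.selfAdjoint _ _ _
    have e4 : inner ℝ (J.L c v) v = inner ℝ v (J.L c v) := J.selfAdjoint _ _ _
    rw [← real_inner_self_eq_norm_sq, ← real_inner_self_eq_norm_sq]
    simp only [inner_sub_left, inner_sub_right, real_inner_comm (J.L c v) (J.L c (J.L c v))]
    rw [h2] at e2 e3
    simp only [inner_sub_right, inner_smul_right] at e2 e3
    linarith
  rw [key]
  positivity

theorem orthogonal_idempotents_commute (hc : J.L c c = c) (hcd : J.L c d = 0) (v : V) :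
    J.L c (J.L d v) = J.L d (J.L c v) := by
  have h := J.linearized_jordan c c d v
  rw [J.mul_comm d c, hcd, hc] at h
  simp only [map_zero, LinearMap.zero_apply, add_zero, zero_add] at h
  exact h.symm

end Idempotents

/-! ### Powers of an element and the spectral theorem. -/

section Powers

/-- The linearized identity expresses `L (xⁿ⁺²)` through `L x`, `L (x²)`, `L (xⁿ)` and `L (xⁿ⁺¹)`;
hence the two-step induction. -/
theorem L_pow_commute (x : V) (n : ℕ) (v : V) :
    J.L x (J.L ((J.L x ^ n) J.e) v) = J.L ((J.L x ^ n) J.e) (J.L x v) := by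
  induction n using Nat.twoStepInduction generalizing v with
  | zero => simp [J.unit_mul]
  | one => simp [J.mul_unit]
  | more n h0 h1 =>
    set a := (J.L x ^ n) J.e with ha
    have e1 : (J.L x ^ (n + 1)) J.e = J.L x a := by rw [pow_succ', Module.End.mul_apply]
    have e2 : (J.L x ^ (n + 2)) J.e = J.L x (J.L x a) := by
      rw [pow_succ', Module.End.mul_apply, e1]
    rw [e1] at h1
    rw [e2]
    have h : ∀ v, J.L (J.L x (J.L x a)) v = J.L (J.L x x) (J.L a v) +
        (2 : ℝ) • J.L (J.L x a) (J.L x v) - J.L x (J.L x (J.L a v)) -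
        J.L a (J.L x (J.L x v)) := by
      intro v
      have := J.linearized_jordan_operator x a x v
      rw [J.mul_comm (J.L x a) x, J.mul_comm a x] at this
      linear_combination (norm := module) this
    rw [h, h]
    simp only [map_add, map_sub, map_smul, J.jordan, h0, h1]

theorem powerSpan_commute {x a : V}
    (ha : a ∈ Submodule.span ℝ (Set.range fun n : ℕ => (J.L x ^ n) J.e)) (v : V) :
    J.L x (J.L a v) = J.L a (J.L x v) := by
  induction ha using Submodule.span_induction with
  | mem a h => obtain ⟨n, rfl⟩ := h; exact J.L_pow_commute x n v
  | zero => simp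
  | add a b _ _ ha hb => simp [ha, hb]
  | smul t a _ ha => simp [ha]

end Powers

variable [FiniteDimensional ℝ V]

/-- The spectral theorem. -/
theorem nonempty_spectralDecomposition (x : V) : Nonempty (J.SpectralDecomposition x) := by
  set A := Submodule.span ℝ (Set.range fun n : ℕ => (J.L x ^ n) J.e) with hA
  have hinv : ∀ v ∈ A, J.L x v ∈ A := by
    intro v hv
    induction hv using Submodule.span_induction with
    | mem a h =>
      obtain ⟨n, rfl⟩ := h
      exact Submodule.subset_span ⟨n + 1, by simp [pow_succ']⟩
    | zero => simp
    | add a b _ _ ha hb => rw [map_add]; exact A.add_mem ha hb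
    | smul t a _ ha => rw [map_smul]; exact A.smul_mem t ha
  have heA : J.e ∈ A := Submodule.subset_span ⟨0, by simp⟩
  have hsym := (J.isSymmetric_L x).restrict_invariant hinv
  have htop : (⨆ μ : ℝ, Module.End.eigenspace ((J.L x).restrict hinv) μ) = ⊤ := by
    have := hsym.orthogonalComplement_iSup_eigenspaces_eq_bot
    rwa [Submodule.orthogonal_eq_bot_iff] at this
  have hmem : (⟨J.e, heA⟩ : A) ∈ ⨆ μ : ℝ, Module.End.eigenspace ((J.L x).restrict hinv) μ := by
    rw [htop]; trivial
  -- The components of `e` in the eigenspaces of `L x` on the span of the powers will be the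
  -- idempotents.
  obtain ⟨f, hf, hsum⟩ := (Submodule.mem_iSup_iff_exists_finsupp _ _).1 hmem
  have hev : ∀ μ, J.L x (f μ : V) = μ • (f μ : V) := fun μ => by
    have := congrArg Subtype.val (Module.End.mem_eigenspace_iff.1 (hf μ))
    simpa using this
  -- Both factors lie in the power span, so `L x` acts on their product by `μ` and also by `ν`.
  have hort : ∀ μ ν, μ ≠ ν → J.L (f μ : V) (f ν : V) = 0 := by
    intro μ ν hne
    have h1 := J.powerSpan_commute (f μ).2 (f ν : V)
    have h2 := J.powerSpan_commute (f ν).2 (f μ : V)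
    rw [hev, map_smul] at h1 h2
    rw [J.mul_comm (f ν : V)] at h2
    have h3 : (μ - ν) • J.L (f μ : V) (f ν : V) = 0 := by rw [sub_smul, ← h1, ← h2, sub_self]
    exact (smul_eq_zero.1 h3).resolve_left (sub_ne_zero.2 hne)
  have hsumV : ∑ μ ∈ f.support, (f μ : V) = J.e := by
    have := congrArg Subtype.val hsum
    simpa [Finsupp.sum] using this
  let φ := f.support.equivFin.symm
  have hreidx : ∀ g : ℝ → V, ∑ i, g (φ i) = ∑ μ ∈ f.support, g μ := fun g => by
    rw [Equiv.sum_comp φ (fun μ : f.support => g μ), Finset.sum_coe_sort f.support g]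
  refine ⟨⟨_, fun i => (φ i : ℝ), fun i => (f (φ i) : V), ?_, ?_, ?_, ?_, ?_, ?_⟩⟩
  · exact Subtype.val_injective.comp φ.injective
  · intro i h
    exact Finsupp.mem_support_iff.1 (φ i).2 (by ext; simpa using h)
  · intro i
    have h := J.mul_unit (f (φ i) : V)
    rw [← hsumV, map_sum, Finset.sum_eq_single (φ i : ℝ)] at h
    · exact h
    · intro μ _ hμ; exact hort _ _ hμ.symm
    · intro h'; exact absurd (φ i).2 h'
  · intro i j hij
    exact hort _ _ fun h => hij (φ.injective (Subtype.ext h))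
  · rw [hreidx fun μ => (f μ : V), hsumV]
  · rw [hreidx fun μ => μ • (f μ : V), ← J.mul_unit x, ← hsumV, map_sum]
    simp only [hev]

end EuclideanJordanAlgebra

/-! ### Complete systems of idempotents and the Peirce decomposition. -/

namespace EuclideanJordanAlgebra

variable {V : Type*} [NormedAddCommGroup V] [InnerProductSpace ℝ V]

/-- A complete system of nonzero orthogonal idempotents. -/
structure IsCompleteSystem (J : EuclideanJordanAlgebra V) {ι : Type*} [Fintype ι]
    (c : ι → V) : Prop where
  ne_zero : ∀ i, c i ≠ 0
  idempotent : ∀ i, J.L (c i) (c i) = c i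
  orthogonal : ∀ i j, i ≠ j → J.L (c i) (c j) = 0
  complete : ∑ i, c i = J.e

variable {J : EuclideanJordanAlgebra V}

theorem SpectralDecomposition.isCompleteSystem {x : V} (D : J.SpectralDecomposition x) :
    J.IsCompleteSystem D.c := ⟨D.c_ne_zero, D.idempotent, D.orthogonal, D.complete⟩

namespace IsCompleteSystem

variable {ι : Type*} [Fintype ι] {c : ι → V} (hc : J.IsCompleteSystem c)
include hc

theorem L_sum_apply (a : ι → ℝ) (j : ι) : J.L (∑ i, a i • c i) (c j) = a j • c j := by
  rw [map_sum, LinearMap.sum_apply, Finset.sum_eq_single j]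
  · rw [map_smul, LinearMap.smul_apply, hc.idempotent]
  · intro i _ hij
    rw [map_smul, LinearMap.smul_apply, hc.orthogonal i j hij, smul_zero]
  · simp

theorem L_sum_sum (a b : ι → ℝ) :
    J.L (∑ i, a i • c i) (∑ i, b i • c i) = ∑ i, (a i * b i) • c i := by
  rw [map_sum]
  refine Finset.sum_congr rfl fun j _ => ?_
  rw [map_smul, hc.L_sum_apply, smul_smul, _root_.mul_comm]

theorem inner_eq_zero {i j : ι} (hij : i ≠ j) : inner ℝ (c i) (c j) = 0 := by
  rw [← hc.idempotent i, J.selfAdjoint, hc.orthogonal i j hij, inner_zero_right]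

theorem inner_sum (a : ι → ℝ) (j : ι) : inner ℝ (∑ i, a i • c i) (c j) = a j * ‖c j‖ ^ 2 := by
  rw [sum_inner, Finset.sum_eq_single j]
  · rw [real_inner_smul_left, real_inner_self_eq_norm_sq]
  · intro i _ hij
    rw [real_inner_smul_left, hc.inner_eq_zero hij, mul_zero]
  · simp

theorem norm_sq_pos (j : ι) : 0 < ‖c j‖ ^ 2 := by
  have := norm_pos_iff.2 (hc.ne_zero j)
  positivity

theorem sum_injective {a b : ι → ℝ} (h : ∑ i, a i • c i = ∑ i, b i • c i) : a = b := by
  funext j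
  have h1 := hc.inner_sum a j
  rw [h, hc.inner_sum] at h1
  exact (mul_right_cancel₀ (hc.norm_sq_pos j).ne' h1).symm

theorem inner_nonneg {a : ι → ℝ} (ha : ∀ i, 0 ≤ a i) (v : V) :
    0 ≤ inner ℝ (J.L (∑ i, a i • c i) v) v := by
  rw [map_sum, LinearMap.sum_apply, sum_inner]
  refine Finset.sum_nonneg fun i _ => ?_
  rw [map_smul, LinearMap.smul_apply, real_inner_smul_left]
  exact mul_nonneg (ha i) (idempotent_inner_nonneg (hc.idempotent i) v)

open Polynomial in
theorem aeval_L_apply (a : ι → ℝ) (p : ℝ[X]) :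
    aeval (J.L (∑ i, a i • c i)) p J.e = ∑ i, p.eval (a i) • c i := by
  rw [← hc.complete, map_sum]
  refine Finset.sum_congr rfl fun i _ => ?_
  exact Module.End.aeval_apply_of_hasEigenvector
    ⟨Module.End.mem_eigenspace_iff.2 (hc.L_sum_apply a i), hc.ne_zero i⟩

/-- The polynomial `∏ (X - bⱼ)` annihilates the element in the system `d`, hence in `c` too, since
`aeval_L_apply` computes it in either. So the spectrum does not depend on the decomposition. -/
theorem range_subset_range {κ : Type*} [Fintype κ] {d : κ → V} (hd : J.IsCompleteSystem d)
    {a : ι → ℝ} {b : κ → ℝ} (h : ∑ i, a i • c i = ∑ j, b j • d j) :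
    Set.range a ⊆ Set.range b := by
  classical
  rintro _ ⟨i, rfl⟩
  have h1 := hc.aeval_L_apply a (∏ j, (Polynomial.X - Polynomial.C (b j)))
  rw [h, hd.aeval_L_apply] at h1
  have h2 : ∑ j, (0 : ℝ) • d j = ∑ i, (∏ j, (a i - b j)) • c i := by
    simp only [Polynomial.eval_prod, Polynomial.eval_sub, Polynomial.eval_X,
      Polynomial.eval_C] at h1
    rw [← h1]
    refine Finset.sum_congr rfl fun j _ => ?_
    rw [Finset.prod_eq_zero (Finset.mem_univ j) (sub_self _)]
  have h3 : ∑ i, (0 : ι → ℝ) i • c i = ∑ i, (∏ j, (a i - b j)) • c i := by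
    rw [← h2]; simp
  have h4 := congrFun (hc.sum_injective h3) i
  obtain ⟨j, _, hj⟩ := Finset.prod_eq_zero_iff.1 h4.symm
  exact ⟨j, (sub_eq_zero.1 hj).symm⟩

/-- The `μ i` lie in `{0, 1/2, 1}` and sum to `1`: either one of them is `1` (then `k = l`) or
exactly two are `1/2`. -/
theorem peirce_eigenvalue {v : V} (hv : v ≠ 0) {μ : ι → ℝ} (h : ∀ i, J.L (c i) v = μ i • v) :
    ∃ k l, ∀ a : ι → ℝ, ∑ i, a i * μ i = (a k + a l) / 2 := by
  classical
  have hcub : ∀ i, μ i = 0 ∨ μ i = 1 / 2 ∨ μ i = 1 := by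
    intro i
    have h1 := idempotent_cubic (hc.idempotent i) v
    simp only [h, map_smul, smul_smul, ← sub_smul, ← add_smul] at h1
    have h2 := (smul_eq_zero.1 h1).resolve_right hv
    have h3 : μ i * ((μ i - 1 / 2) * (μ i - 1)) = 0 := by linear_combination h2 / 2
    rcases mul_eq_zero.1 h3 with h | h
    · exact Or.inl h
    · rcases mul_eq_zero.1 h with h | h
      · exact Or.inr (Or.inl (by linarith))
      · exact Or.inr (Or.inr (by linarith))
  have hnn : ∀ i, 0 ≤ μ i := fun i => by rcases hcub i with h | h | h <;> rw [h] <;> norm_num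
  have hsum : ∑ i, μ i = 1 := by
    have h1 : J.L (∑ i, c i) v = v := by rw [hc.complete, J.unit_mul]
    rw [map_sum, LinearMap.sum_apply] at h1
    simp only [h, ← Finset.sum_smul] at h1
    have h2 : (∑ i, μ i - 1) • v = 0 := by rw [sub_smul, h1, one_smul, sub_self]
    exact sub_eq_zero.1 ((smul_eq_zero.1 h2).resolve_right hv)
  have hex : ∃ k, μ k ≠ 0 := by
    by_contra! h0
    simp [h0] at hsum
  obtain ⟨k, hk⟩ := hex
  have hrest := Finset.add_sum_erase Finset.univ μ (Finset.mem_univ k)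
  rw [hsum] at hrest
  rcases (hcub k).resolve_left hk with hk | hk
  · have h2 : ∑ i ∈ Finset.univ.erase k, μ i = 1 / 2 := by linarith
    have : ∃ l ∈ Finset.univ.erase k, μ l ≠ 0 := by
      by_contra! h0
      rw [Finset.sum_eq_zero h0] at h2
      norm_num at h2
    obtain ⟨l, hl, hl0⟩ := this
    have h3 := Finset.add_sum_erase _ μ hl
    have hl1 : μ l = 1 / 2 := by
      rcases (hcub l).resolve_left hl0 with h | h
      · exact h
      · have := Finset.sum_nonneg fun i (_ : i ∈ (Finset.univ.erase k).erase l) => hnn i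
        linarith
    have h4 : ∑ i ∈ (Finset.univ.erase k).erase l, μ i = 0 := by linarith
    rw [Finset.sum_eq_zero_iff_of_nonneg fun i _ => hnn i] at h4
    refine ⟨k, l, fun a => ?_⟩
    rw [← Finset.add_sum_erase _ _ (Finset.mem_univ k), ← Finset.add_sum_erase _ _ hl,
      Finset.sum_eq_zero fun i hi => by rw [h4 i hi, mul_zero], hk, hl1]
    ring
  · have h4 : ∑ i ∈ Finset.univ.erase k, μ i = 0 := by linarith
    rw [Finset.sum_eq_zero_iff_of_nonneg fun i _ => hnn i] at h4
    refine ⟨k, k, fun a => ?_⟩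
    rw [← Finset.add_sum_erase _ _ (Finset.mem_univ k),
      Finset.sum_eq_zero fun i hi => by rw [h4 i hi, mul_zero], hk]
    ring

end IsCompleteSystem

theorem SpectralDecomposition.L_apply {x : V} (D : J.SpectralDecomposition x) (i : Fin D.k) :
    J.L x (D.c i) = D.eig i • D.c i :=
  (congrArg (fun w => J.L w (D.c i)) D.decomp).trans (D.isCompleteSystem.L_sum_apply _ i)

/-- The union of the Peirce spaces of a complete system of idempotents: the vectors on which
every `L (∑ aᵢ cᵢ)` acts by `(aₖ + aₗ) / 2`, for some `k` and `l`. -/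
def peirceVectors (J : EuclideanJordanAlgebra V) {ι : Type*} [Fintype ι] (c : ι → V) : Set V :=
  {v | ∃ k l, ∀ a : ι → ℝ, J.L (∑ i, a i • c i) v = ((a k + a l) / 2) • v}

/-- The operators `L (cᵢ)` are symmetric and commute, so they are simultaneously diagonalizable. -/
theorem IsCompleteSystem.span_peirceVectors [FiniteDimensional ℝ V] {ι : Type*} [Fintype ι]
    {c : ι → V} (hc : J.IsCompleteSystem c) : Submodule.span ℝ (J.peirceVectors c) = ⊤ := by
  classical
  have htop := LinearMap.IsSymmetric.iSup_iInf_eq_top_of_commute (T := fun i => J.L (c i))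
    (fun i => J.isSymmetric_L (c i)) (fun i j hij => by
      ext v
      exact orthogonal_idempotents_commute (hc.idempotent i) (hc.orthogonal i j hij) v)
  rw [eq_top_iff, ← htop]
  refine iSup_le fun μ v hv => ?_
  by_cases hv0 : v = 0
  · rw [hv0]; exact Submodule.zero_mem _
  have h : ∀ i, J.L (c i) v = μ i • v := fun i =>
    Module.End.mem_eigenspace_iff.1 ((Submodule.mem_iInf _).1 hv i)
  obtain ⟨k, l, hkl⟩ := hc.peirce_eigenvalue hv0 h
  refine Submodule.subset_span ⟨k, l, fun a => ?_⟩
  rw [map_sum, LinearMap.sum_apply, ← hkl, Finset.sum_smul]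
  refine Finset.sum_congr rfl fun i _ => ?_
  rw [map_smul, LinearMap.smul_apply, h, smul_smul]

theorem IsCompleteSystem.P_apply_of_peirce {ι : Type*} [Fintype ι]
    {c : ι → V} (hc : J.IsCompleteSystem c) {v : V} {k l : ι}
    (hv : ∀ a : ι → ℝ, J.L (∑ i, a i • c i) v = ((a k + a l) / 2) • v) (a : ι → ℝ) :
    J.P (∑ i, a i • c i) v = (a k * a l) • v := by
  simp only [P, LinearMap.sub_apply, LinearMap.smul_apply, LinearMap.comp_apply, hc.L_sum_sum,
    hv, map_smul, smul_smul, ← sub_smul]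
  congr 1
  ring

theorem IsCompleteSystem.P_P_apply [FiniteDimensional ℝ V] {ι : Type*} [Fintype ι]
    {c : ι → V} (hc : J.IsCompleteSystem c) {a b : ι → ℝ} (hab : ∀ i, a i * b i = 1) (v : V) :
    J.P (∑ i, a i • c i) (J.P (∑ i, b i • c i) v) = v := by
  have : J.P (∑ i, a i • c i) ∘ₗ J.P (∑ i, b i • c i) = LinearMap.id := by
    refine LinearMap.ext_on hc.span_peirceVectors ?_
    rintro v ⟨k, l, hv⟩
    rw [LinearMap.comp_apply, hc.P_apply_of_peirce hv, map_smul, hc.P_apply_of_peirce hv,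
      smul_smul, LinearMap.id_apply]
    rw [show b k * b l * (a k * a l) = (a k * b k) * (a l * b l) by ring, hab, hab, one_mul,
      one_smul]
  exact LinearMap.congr_fun this v

theorem IsCompleteSystem.P_sum_sum {ι : Type*} [Fintype ι]
    {c : ι → V} (hc : J.IsCompleteSystem c) (a b : ι → ℝ) :
    J.P (∑ i, a i • c i) (∑ i, b i • c i) = ∑ i, (a i ^ 2 * b i) • c i := by
  simp only [P, LinearMap.sub_apply, LinearMap.smul_apply, LinearMap.comp_apply, hc.L_sum_sum,
    Finset.smul_sum, smul_smul, ← Finset.sum_sub_distrib, ← sub_smul]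
  refine Finset.sum_congr rfl fun i _ => ?_
  congr 1
  ring

/-! ### The cone of squares and its interior. -/

variable [FiniteDimensional ℝ V]

/-- Squares have nonnegative coefficients on idempotents, which act positively; conversely, testing
on the `cᵢ` shows that the eigenvalues have square roots. Convexity and closedness of `K` and
nonnegativity of inner products on it follow. -/
theorem mem_coneOfSquares_iff_inner {x : V} :
    x ∈ J.coneOfSquares ↔ ∀ v, 0 ≤ inner ℝ (J.L x v) v := by
  constructor
  · rintro ⟨w, rfl⟩ v
    obtain ⟨D⟩ := J.nonempty_spectralDecomposition w
    rw [D.decomp, D.isCompleteSystem.L_sum_sum]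
    exact D.isCompleteSystem.inner_nonneg (fun i => mul_self_nonneg _) v
  · intro h
    obtain ⟨D⟩ := J.nonempty_spectralDecomposition x
    have hD := D.isCompleteSystem
    have hnn : ∀ i, 0 ≤ D.eig i := by
      intro i
      have h1 := h (D.c i)
      rw [D.L_apply, real_inner_smul_left, real_inner_self_eq_norm_sq] at h1
      exact nonneg_of_mul_nonneg_left h1 (hD.norm_sq_pos i)
    refine ⟨∑ i, √(D.eig i) • D.c i, ?_⟩
    rw [hD.L_sum_sum]
    refine D.decomp.trans (Finset.sum_congr rfl fun i _ => ?_)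
    rw [Real.mul_self_sqrt (hnn i)]

theorem IsCompleteSystem.sum_mem_coneOfSquares_iff {ι : Type*} [Fintype ι]
    {c : ι → V} (hc : J.IsCompleteSystem c) {a : ι → ℝ} :
    ∑ i, a i • c i ∈ J.coneOfSquares ↔ ∀ i, 0 ≤ a i := by
  rw [mem_coneOfSquares_iff_inner]
  refine ⟨fun h i => ?_, hc.inner_nonneg⟩
  have h1 := h (c i)
  rw [hc.L_sum_apply, real_inner_smul_left, real_inner_self_eq_norm_sq] at h1
  exact nonneg_of_mul_nonneg_left h1 (hc.norm_sq_pos i)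

theorem add_mem_coneOfSquares {x y : V} (hx : x ∈ J.coneOfSquares) (hy : y ∈ J.coneOfSquares) :
    x + y ∈ J.coneOfSquares := by
  rw [mem_coneOfSquares_iff_inner] at *
  intro v
  rw [map_add, LinearMap.add_apply, inner_add_left]
  exact add_nonneg (hx v) (hy v)

theorem smul_mem_coneOfSquares {x : V} (hx : x ∈ J.coneOfSquares) {t : ℝ} (ht : 0 ≤ t) :
    t • x ∈ J.coneOfSquares := by
  rw [mem_coneOfSquares_iff_inner] at *
  intro v
  rw [map_smul, LinearMap.smul_apply, real_inner_smul_left]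
  exact mul_nonneg ht (hx v)

theorem inner_nonneg_of_mem {x y : V} (hx : x ∈ J.coneOfSquares) (hy : y ∈ J.coneOfSquares) :
    0 ≤ inner ℝ x y := by
  obtain ⟨w, rfl⟩ := hy
  rw [← inner_mul_self]
  exact mem_coneOfSquares_iff_inner.1 hx w

theorem isClosed_coneOfSquares : IsClosed J.coneOfSquares := by
  have : J.coneOfSquares = ⋂ v : V, {x | 0 ≤ inner ℝ x (J.L v v)} := by
    ext x
    simp only [mem_coneOfSquares_iff_inner, inner_mul_self, Set.mem_iInter, Set.mem_ofPred_eq]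
  rw [this]
  exact isClosed_iInter fun v => isClosed_le continuous_const (by fun_prop)

/-- The operator `L x` is positive semidefinite and `⟨L x c, c⟩ = ⟨x, c⟩ = 0`, so `c` lies in its
kernel. -/
theorem mul_eq_zero_of_inner_eq_zero {x c : V} (hx : x ∈ J.coneOfSquares) (hc : J.L c c = c)
    (h : inner ℝ x c = 0) : J.L x c = 0 := by
  have h0 : inner ℝ (J.L x c) c = 0 := by rw [inner_mul_self, hc, h]
  have hpsd := mem_coneOfSquares_iff_inner.1 hx
  set w := J.L x c with hw
  set m := inner ℝ (J.L x w) w with hm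
  have hm0 : 0 ≤ m := hpsd w
  have key : ∀ s : ℝ, 0 ≤ s ^ 2 * m - 2 * s * ‖w‖ ^ 2 := by
    intro s
    have h1 := hpsd (c - s • w)
    have h2 : inner ℝ (J.L x w) c = ‖w‖ ^ 2 := by
      rw [J.selfAdjoint, ← hw, real_inner_self_eq_norm_sq]
    simp only [map_sub, map_smul, ← hw, inner_sub_left, inner_sub_right, real_inner_smul_left,
      real_inner_smul_right, h0, h2, ← hm, real_inner_self_eq_norm_sq] at h1
    linarith
  -- Near the minimizer `‖w‖² / m`; the `+ 1` covers `m = 0`.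
  have h3 := key (‖w‖ ^ 2 / (m + 1))
  have h4 : (‖w‖ ^ 2 / (m + 1)) ^ 2 * m - 2 * (‖w‖ ^ 2 / (m + 1)) * ‖w‖ ^ 2 =
      -((‖w‖ ^ 2 / (m + 1)) ^ 2 * (m + 2)) := by
    have : m + 1 ≠ 0 := by positivity
    field_simp
    ring
  rw [h4] at h3
  have h5 : (‖w‖ ^ 2 / (m + 1)) ^ 2 * (m + 2) = 0 := le_antisymm (by linarith) (by positivity)
  have h6 : ‖w‖ ^ 2 / (m + 1) = 0 := by
    have := (mul_eq_zero.1 h5).resolve_right (by positivity)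
    exact pow_eq_zero_iff two_ne_zero |>.1 this
  have h7 : ‖w‖ ^ 2 = 0 := (div_eq_zero_iff.1 h6).resolve_right (by positivity)
  exact norm_eq_zero.1 (pow_eq_zero_iff two_ne_zero |>.1 h7)

theorem exists_bound_L : ∃ C : ℝ, 0 < C ∧ ∀ u v : V, |inner ℝ (J.L u v) v| ≤ C * ‖u‖ * ‖v‖ ^ 2 := by
  let B : V →L[ℝ] V →L[ℝ] V := LinearMap.toContinuousLinearMap
    ((LinearMap.toContinuousLinearMap : (V →ₗ[ℝ] V) ≃ₗ[ℝ] (V →L[ℝ] V)).toLinearMap ∘ₗ J.L)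
  refine ⟨‖B‖ + 1, by positivity, fun u v => ?_⟩
  have h1 : ‖J.L u v‖ ≤ ‖B‖ * ‖u‖ * ‖v‖ := B.le_opNorm₂ u v
  calc |inner ℝ (J.L u v) v| ≤ ‖J.L u v‖ * ‖v‖ := abs_real_inner_le_norm _ _
    _ ≤ ‖B‖ * ‖u‖ * ‖v‖ * ‖v‖ := by gcongr
    _ ≤ (‖B‖ + 1) * ‖u‖ * ‖v‖ * ‖v‖ := by gcongr; linarith
    _ = _ := by ring

omit [FiniteDimensional ℝ V] in
theorem exists_sub_smul_mem {x : V} (hx : x ∈ J.symmetricCone) (z : V) :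
    ∃ ε : ℝ, 0 < ε ∧ x - ε • z ∈ J.coneOfSquares := by
  have hcont : Filter.Tendsto (fun ε : ℝ => x - ε • z) (nhds 0) (nhds x) := by
    have : Continuous fun ε : ℝ => x - ε • z := by fun_prop
    simpa using this.tendsto 0
  have h1 := (hcont.mono_left (nhdsWithin_le_nhds (s := Set.Ioi 0))).eventually
    (mem_interior_iff_mem_nhds.1 hx)
  obtain ⟨ε, h2, h3⟩ := (h1.and self_mem_nhdsWithin).exists
  exact ⟨ε, h3, h2⟩

theorem mem_symmetricCone_iff {x : V} :
    x ∈ J.symmetricCone ↔ ∃ ε : ℝ, 0 < ε ∧ x - ε • J.e ∈ J.coneOfSquares := by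
  constructor
  · exact fun hx => exists_sub_smul_mem hx J.e
  · rintro ⟨ε, hε, h⟩
    obtain ⟨C, hC, hB⟩ := J.exists_bound_L
    refine mem_interior_iff_mem_nhds.2 (Metric.mem_nhds_iff.2 ⟨ε / C, by positivity, ?_⟩)
    intro y hy
    have hy' : C * ‖y - x‖ ≤ ε := by
      have := (lt_div_iff₀ hC).1 (mem_ball_iff_norm.1 hy)
      linarith
    have h1 : (y - x) + ε • J.e ∈ J.coneOfSquares := by
      rw [mem_coneOfSquares_iff_inner]
      intro v
      rw [map_add, LinearMap.add_apply, map_smul, LinearMap.smul_apply, J.unit_mul,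
        inner_add_left, real_inner_smul_left, real_inner_self_eq_norm_sq]
      have h2 := (abs_le.1 (hB (y - x) v)).1
      have h3 : C * ‖y - x‖ * ‖v‖ ^ 2 ≤ ε * ‖v‖ ^ 2 := by gcongr
      linarith
    have h2 := add_mem_coneOfSquares h h1
    rwa [show x - ε • J.e + (y - x + ε • J.e) = y by abel] at h2

theorem IsCompleteSystem.sum_mem_symmetricCone_iff {ι : Type*} [Fintype ι]
    {c : ι → V} (hc : J.IsCompleteSystem c) {a : ι → ℝ} :
    ∑ i, a i • c i ∈ J.symmetricCone ↔ ∀ i, 0 < a i := by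
  have key : ∀ ε : ℝ, ∑ i, a i • c i - ε • J.e = ∑ i, (a i - ε) • c i := fun ε => by
    rw [← hc.complete, Finset.smul_sum, ← Finset.sum_sub_distrib]
    simp only [sub_smul]
  simp only [mem_symmetricCone_iff, key, hc.sum_mem_coneOfSquares_iff]
  constructor
  · rintro ⟨ε, hε, h⟩ i
    linarith [h i]
  · intro h
    cases isEmpty_or_nonempty ι
    · exact ⟨1, one_pos, fun i => isEmptyElim i⟩
    · obtain ⟨i, hi⟩ := Finite.exists_min a
      exact ⟨a i, h i, fun j => sub_nonneg.2 (hi j)⟩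

/-! ### Invariance of the cone under the quadratic representation. -/

/-- The resolvent of a multiplication operator preserves the cone of squares. -/
theorem mem_coneOfSquares_of_sub_mul_mem {u y : V} {C : ℝ}
    (hC : ∀ v : V, inner ℝ (J.L u v) v ≤ C * ‖v‖ ^ 2) (hC1 : C < 1)
    (h : y - J.L u y ∈ J.coneOfSquares) : y ∈ J.coneOfSquares := by
  obtain ⟨D⟩ := J.nonempty_spectralDecomposition y
  have hD := D.isCompleteSystem
  set p := ∑ i, max (D.eig i) 0 • D.c i with hp
  set q := ∑ i, max (-D.eig i) 0 • D.c i with hq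
  have hpK : p ∈ J.coneOfSquares := hD.sum_mem_coneOfSquares_iff.2 fun i => le_max_right _ _
  have hqK : q ∈ J.coneOfSquares := hD.sum_mem_coneOfSquares_iff.2 fun i => le_max_right _ _
  have hy : y = p - q := by
    rw [hp, hq, ← Finset.sum_sub_distrib]
    refine D.decomp.trans (Finset.sum_congr rfl fun i _ => ?_)
    rw [← sub_smul]
    congr 1
    rcases le_total (D.eig i) 0 with h | h
    · rw [max_eq_right h, max_eq_left (by linarith)]; ring
    · rw [max_eq_left h, max_eq_right (by linarith)]; ring
  have hpq : J.L p q = 0 := by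
    rw [hp, hq, hD.L_sum_sum]
    refine Finset.sum_eq_zero fun i _ => ?_
    rcases le_total (D.eig i) 0 with h | h
    · rw [max_eq_right h, zero_mul, zero_smul]
    · rw [max_eq_right (by linarith : -D.eig i ≤ 0), mul_zero, zero_smul]
  have hinn : inner ℝ p q = 0 := by
    rw [← J.mul_unit p, J.selfAdjoint, hpq, inner_zero_right]
  have hupq : inner ℝ (J.L u p) q = 0 := by
    rw [J.mul_comm, J.selfAdjoint, hpq, inner_zero_right]
  -- With `p`, `q` the positive and negative parts of `y`, pairing with `q` leaves `-‖q‖² + ⟨u • q,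
  -- q⟩ ≥ 0`.
  have h1 := inner_nonneg_of_mem h hqK
  rw [hy, map_sub, inner_sub_left, inner_sub_left, inner_sub_left, hinn, hupq,
    real_inner_self_eq_norm_sq] at h1
  have h2 := hC q
  have h3 : ‖q‖ ^ 2 * (1 - C) ≤ 0 := by linarith
  have h4 : ‖q‖ ^ 2 ≤ 0 := by
    by_contra! h5
    have := mul_pos h5 (sub_pos.2 hC1)
    linarith
  have h5 : q = 0 := by
    rw [← norm_eq_zero]
    exact pow_eq_zero_iff two_ne_zero |>.1 (le_antisymm h4 (by positivity))
  rw [hy, h5, sub_zero]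
  exact hpK

/-- The quadratic representation of a positive element preserves the cone of squares. -/
theorem IsCompleteSystem.P_mem_coneOfSquares {ι : Type*} [Fintype ι]
    {c : ι → V} (hc : J.IsCompleteSystem c) {a : ι → ℝ} (ha : ∀ i, 0 < a i) {x : V}
    (hx : x ∈ J.coneOfSquares) : J.P (∑ i, a i • c i) x ∈ J.coneOfSquares := by
  have hxs : x ∈ Submodule.span ℝ (J.peirceVectors c) := by rw [hc.span_peirceVectors]; trivial
  obtain ⟨n, f, g, hsum⟩ := Submodule.mem_span_set'.1 hxs
  choose k l hkl using fun j => (g j).2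
  set u := ∑ i, (2 * Real.log (a i)) • c i with hu
  set μ : Fin n → ℝ := fun j => Real.log (a (k j)) + Real.log (a (l j)) with hμ
  have hLu : ∀ j, J.L u (g j) = μ j • (g j : V) := fun j => by
    rw [hu, hkl j]; congr 1; simp only [hμ]; ring
  have hP : J.P (∑ i, a i • c i) x = ∑ j, (f j * Real.exp (μ j)) • (g j : V) := by
    rw [← hsum, map_sum]
    refine Finset.sum_congr rfl fun j _ => ?_
    rw [map_smul, hc.P_apply_of_peirce (hkl j), smul_smul, hμ]
    simp only [Real.exp_add, Real.exp_log (ha _)]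
  obtain ⟨C, hC, hB⟩ := J.exists_bound_L
  -- For `u = 2 log a` the map `P(a)` is `exp(L u)`, the limit of `(1 - L u / N)^{-N}`. Each
  -- resolvent preserves the cone once `N` exceeds `C * ‖u‖`.
  have hstep : ∀ N : ℕ, C * ‖u‖ < N → (∀ j, 1 + -μ j / N ≠ 0) → ∀ m : ℕ,
      ∑ j, (f j * ((1 + -μ j / N) ^ m)⁻¹) • (g j : V) ∈ J.coneOfSquares := by
    intro N hN hne m
    have hN0 : (0 : ℝ) < N := lt_of_le_of_lt (by positivity) hN
    induction m with
    | zero => simpa [hsum] using hx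
    | succ m ih =>
      refine mem_coneOfSquares_of_sub_mul_mem (u := (N : ℝ)⁻¹ • u) (C := (N : ℝ)⁻¹ * (C * ‖u‖))
        (fun v => ?_) ?_ ?_
      · rw [map_smul, LinearMap.smul_apply, real_inner_smul_left, mul_assoc]
        exact mul_le_mul_of_nonneg_left ((le_abs_self _).trans (hB u v)) (by positivity)
      · rw [inv_mul_lt_iff₀ hN0, mul_one]; exact hN
      · convert ih using 1
        rw [map_sum, ← Finset.sum_sub_distrib]
        refine Finset.sum_congr rfl fun j _ => ?_
        rw [map_smul, map_smul, LinearMap.smul_apply, hLu, smul_smul, smul_smul, ← sub_smul,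
          mul_assoc (f j * _)]
        congr 1
        have := hne j
        rw [pow_succ, mul_inv]
        calc f j * (((1 + -μ j / N) ^ m)⁻¹ * (1 + -μ j / N)⁻¹) -
              f j * (((1 + -μ j / N) ^ m)⁻¹ * (1 + -μ j / N)⁻¹) * ((N : ℝ)⁻¹ * μ j)
            = f j * ((1 + -μ j / N) ^ m)⁻¹ * ((1 + -μ j / N)⁻¹ * (1 + -μ j / N)) := by ring
          _ = _ := by rw [inv_mul_cancel₀ this, mul_one]
  have hlim : Filter.Tendsto (fun N : ℕ => ∑ j, (f j * ((1 + -μ j / N) ^ N)⁻¹) • (g j : V))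
      Filter.atTop (nhds (∑ j, (f j * Real.exp (μ j)) • (g j : V))) := by
    refine tendsto_finsetSum _ fun j _ => Filter.Tendsto.smul_const ?_ _
    refine Filter.Tendsto.const_mul _ ?_
    have := (Real.tendsto_one_add_div_pow_exp (-μ j)).inv₀ (Real.exp_ne_zero _)
    rwa [← Real.exp_neg, neg_neg] at this
  rw [hP]
  refine isClosed_coneOfSquares.mem_of_tendsto hlim ?_
  have hne : ∀ᶠ N : ℕ in Filter.atTop, ∀ j, 1 + -μ j / N ≠ 0 := by
    rw [Filter.eventually_all]
    intro j
    have h1 : Filter.Tendsto (fun N : ℕ => 1 + -μ j / N) Filter.atTop (nhds (1 + 0)) :=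
      tendsto_const_nhds.add (tendsto_const_div_atTop_nhds_zero_nat _)
    exact h1.eventually_ne (by norm_num)
  filter_upwards [hne, tendsto_natCast_atTop_atTop.eventually_gt_atTop (C * ‖u‖)] with N h1 h2
  exact hstep N h2 h1 N

end EuclideanJordanAlgebra

/-! ### Transport of geodesics by cone automorphisms. -/

theorem thompsonDist_map {V : Type*} [AddCommGroup V] [Module ℝ V] {C : Set V} (T : V ≃ₗ[ℝ] V) (hT : ∀ v, T v ∈ C ↔ v ∈ C) (x y : V) :
    thompsonDist C (T x) (T y) = thompsonDist C x y := by
  have h : ∀ (u v : V) (β : ℝ), ConeLE C (T u) (β • T v) ↔ ConeLE C u (β • v) := fun u v β => by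
    simp only [ConeLE]
    rw [← map_smul, ← map_sub, hT]
  have hE : ConeEquiv C (T x) (T y) = ConeEquiv C x y := by
    simp only [ConeEquiv, ConeDominates, h]
  unfold thompsonDist
  rw [hE]
  simp only [coneM, h]

theorem IsGeodesicSegment.image {V : Type*} {d : V → V → ℝ≥0∞} {X : Set V} {x y : V} {S : Set V}
    (hS : IsGeodesicSegment d X x y S) {T : V → V} (hX : ∀ v ∈ X, T v ∈ X)
    (hd : ∀ u v, d (T u) (T v) = d u v) : IsGeodesicSegment d X (T x) (T y) (T '' S) := by
  obtain ⟨a, b, γ, hab, ⟨h1, h2⟩, rfl, rfl, rfl⟩ := hS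
  refine ⟨a, b, T ∘ γ, hab, ⟨fun t ht => hX _ (h1 t ht), fun s hs t ht => ?_⟩, rfl, rfl, ?_⟩
  · rw [← h2 s hs t ht]; exact hd _ _
  · rw [Set.image_comp]

theorem existsUnique_geodesicSegment_map {V : Type*} [AddCommGroup V] [Module ℝ V]
    {d : V → V → ℝ≥0∞} {X : Set V} (x y : V)
    (T : V ≃ₗ[ℝ] V) (hX : ∀ v, T v ∈ X ↔ v ∈ X) (hd : ∀ u v, d (T u) (T v) = d u v) :
    (∃! S, IsGeodesicSegment d X (T x) (T y) S) ↔ ∃! S, IsGeodesicSegment d X x y S := by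
  have hmap : ∀ S, IsGeodesicSegment d X x y S → IsGeodesicSegment d X (T x) (T y) (T '' S) :=
    fun S hS => hS.image (fun v hv => (hX v).2 hv) hd
  have hinv : ∀ S, IsGeodesicSegment d X (T x) (T y) S →
      IsGeodesicSegment d X x y (T.symm '' S) := fun S hS => by
    simpa using hS.image (T := T.symm) (fun v hv => (hX _).1 (by simpa using hv))
      (fun u v => by simpa using (hd (T.symm u) (T.symm v)).symm)
  constructor
  · rintro ⟨S, hS, huniq⟩
    refine ⟨_, hinv S hS, fun S' hS' => ?_⟩
    rw [← huniq _ (hmap S' hS'), ← Set.image_comp]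
    simp
  · rintro ⟨S, hS, huniq⟩
    refine ⟨_, hmap S hS, fun S' hS' => ?_⟩
    rw [← huniq _ (hinv S' hS'), ← Set.image_comp]
    simp

namespace EuclideanJordanAlgebra

variable {V : Type*} [NormedAddCommGroup V] [InnerProductSpace ℝ V]
variable {J : EuclideanJordanAlgebra V}

variable [FiniteDimensional ℝ V]

theorem IsCompleteSystem.spec_sum {ι : Type*} [Fintype ι] {c : ι → V}
    (hc : J.IsCompleteSystem c) (a : ι → ℝ) : J.spec (∑ i, a i • c i) = Set.range a := by
  apply Set.Subset.antisymm
  · rintro t ⟨D, ht⟩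
    exact D.isCompleteSystem.range_subset_range hc D.decomp.symm ht
  · intro t ht
    obtain ⟨D⟩ := J.nonempty_spectralDecomposition (∑ i, a i • c i)
    exact ⟨D, hc.range_subset_range D.isCompleteSystem D.decomp ht⟩

/-- The quadratic representation of `y^{-1/2}` is an automorphism of the cone of squares that
maps `y` to the unit. -/
theorem exists_P_invSqrt_equiv {y : V} (hy : y ∈ J.symmetricCone) :
    ∃ T : V ≃ₗ[ℝ] V, (∀ v, T v = J.P (J.invSqrt y) v) ∧
      (∀ v, T v ∈ J.coneOfSquares ↔ v ∈ J.coneOfSquares) ∧ T y = J.e := by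
  have hne := J.nonempty_spectralDecomposition y
  obtain ⟨D, hD⟩ : ∃ D : J.SpectralDecomposition y,
      J.invSqrt y = ∑ i, D.eig i ^ (-(1 / 2) : ℝ) • D.c i := by
    refine ⟨hne.some, ?_⟩
    rw [invSqrt, functionalCalculus, dif_pos hne]
  have hc := D.isCompleteSystem
  have hpos : ∀ i, 0 < D.eig i := by
    rw [← hc.sum_mem_symmetricCone_iff]
    exact D.decomp ▸ hy
  set a : Fin D.k → ℝ := fun i => D.eig i ^ (-(1 / 2) : ℝ) with ha
  have ha0 : ∀ i, 0 < a i := fun i => Real.rpow_pos_of_pos (hpos i) _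
  have hab : ∀ i, a i * (a i)⁻¹ = 1 := fun i => mul_inv_cancel₀ (ha0 i).ne'
  have hba : ∀ i, (a i)⁻¹ * a i = 1 := fun i => inv_mul_cancel₀ (ha0 i).ne'
  -- The inverse is again `P` of a positive element, so the cone is preserved in both directions.
  let T : V ≃ₗ[ℝ] V := LinearEquiv.ofLinearMap (J.P (∑ i, a i • D.c i))
    (J.P (∑ i, (a i)⁻¹ • D.c i)) (LinearMap.ext fun v => hc.P_P_apply hab v)
    (LinearMap.ext fun v => hc.P_P_apply hba v)
  refine ⟨T, fun v => by rw [hD]; rfl, fun v => ⟨fun h => ?_, fun h => ?_⟩, ?_⟩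
  · have := hc.P_mem_coneOfSquares (fun i => inv_pos.2 (ha0 i)) h
    rwa [show J.P (∑ i, (a i)⁻¹ • D.c i) (T v) = v from hc.P_P_apply hba v] at this
  · exact hc.P_mem_coneOfSquares ha0 h
  · refine (congrArg T D.decomp).trans ((hc.P_sum_sum a D.eig).trans ?_)
    rw [← hc.complete]
    refine Finset.sum_congr rfl fun i _ => ?_
    have : a i ^ 2 = (D.eig i)⁻¹ := by
      rw [ha]
      simp only
      rw [← Real.rpow_natCast, ← Real.rpow_mul (hpos i).le, ← Real.rpow_neg_one]
      norm_num
    rw [this, inv_mul_cancel₀ (hpos i).ne', one_smul]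

theorem map_mem_symmetricCone_iff (T : V ≃ₗ[ℝ] V)
    (hT : ∀ v, T v ∈ J.coneOfSquares ↔ v ∈ J.coneOfSquares) (v : V) :
    T v ∈ J.symmetricCone ↔ v ∈ J.symmetricCone := by
  have h1 := T.toContinuousLinearEquiv.toHomeomorph.preimage_interior J.coneOfSquares
  have h2 : T.toContinuousLinearEquiv.toHomeomorph ⁻¹' J.coneOfSquares = J.coneOfSquares :=
    Set.ext hT
  rw [h2] at h1
  exact Set.ext_iff.1 h1 v

/-! ### Thompson's metric on the symmetric cone. -/

theorem exists_coneLE {x y : V} (hy : y ∈ J.symmetricCone) :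
    ∃ β : ℝ, 0 < β ∧ ConeLE J.coneOfSquares x (β • y) := by
  obtain ⟨ε, hε, h⟩ := exists_sub_smul_mem hy x
  refine ⟨ε⁻¹, inv_pos.2 hε, ?_⟩
  have := smul_mem_coneOfSquares h (inv_pos.2 hε).le
  rwa [smul_sub, smul_smul, inv_mul_cancel₀ hε.ne', one_smul] at this

theorem thompsonDist_eq {x y : V} (hx : x ∈ J.symmetricCone) (hy : y ∈ J.symmetricCone) :
    thompsonDist J.coneOfSquares x y = ENNReal.ofReal
      (Real.log (max (coneM J.coneOfSquares x y) (coneM J.coneOfSquares y x))) :=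
  if_pos ⟨exists_coneLE hy, exists_coneLE hx⟩

/-- The infimum defining `coneM` is attained because the cone is closed. -/
theorem coneLE_of_coneM_le {x y : V} (hy : y ∈ J.symmetricCone) {m : ℝ}
    (hm : coneM J.coneOfSquares x y ≤ m) : ConeLE J.coneOfSquares x (m • y) := by
  have hyK : y ∈ J.coneOfSquares := interior_subset hy
  have hlim : Filter.Tendsto (fun η : ℝ => (m + η) • y - x) (nhdsWithin 0 (Set.Ioi 0))
      (nhds (m • y - x)) := by
    have : Continuous fun η : ℝ => (m + η) • y - x := by fun_prop
    simpa using (this.tendsto 0).mono_left nhdsWithin_le_nhds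
  refine isClosed_coneOfSquares.mem_of_tendsto hlim ?_
  filter_upwards [self_mem_nhdsWithin] with η hη
  obtain ⟨β, ⟨_, hβ⟩, hlt⟩ := exists_lt_of_csInf_lt (exists_coneLE (x := x) hy)
    (lt_of_le_of_lt hm (lt_add_of_pos_right m hη))
  have := add_mem_coneOfSquares hβ (smul_mem_coneOfSquares hyK (sub_nonneg.2 hlt.le))
  rwa [show β • y - x + (m + η - β) • y = (m + η) • y - x by module] at this

theorem coneLE_of_thompsonDist_eq {x y : V} (hx : x ∈ J.symmetricCone)
    (hy : y ∈ J.symmetricCone) {δ : ℝ} (hδ : 0 ≤ δ)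
    (h : thompsonDist J.coneOfSquares x y = ENNReal.ofReal δ) :
    ConeLE J.coneOfSquares x (Real.exp δ • y) ∧ ConeLE J.coneOfSquares y (Real.exp δ • x) := by
  rw [thompsonDist_eq hx hy] at h
  have h1 := (ENNReal.ofReal_le_ofReal_iff hδ).1 h.le
  have h2 := Real.le_exp_of_log_le h1
  exact ⟨coneLE_of_coneM_le hy ((le_max_left _ _).trans h2),
    coneLE_of_coneM_le hx ((le_max_right _ _).trans h2)⟩

/-! ### Geodesics in logarithmic coordinates. -/

namespace IsCompleteSystem

variable {ι : Type*} [Fintype ι] {c : ι → V} (hc : J.IsCompleteSystem c)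
include hc

theorem coneLE_sum_iff {a b : ι → ℝ} {β : ℝ} :
    ConeLE J.coneOfSquares (∑ i, a i • c i) (β • ∑ i, b i • c i) ↔ ∀ i, a i ≤ β * b i := by
  have : β • ∑ i, b i • c i - ∑ i, a i • c i = ∑ i, (β * b i - a i) • c i := by
    rw [Finset.smul_sum, ← Finset.sum_sub_distrib]
    simp only [smul_smul, sub_smul]
  simp only [ConeLE, this, hc.sum_mem_coneOfSquares_iff, sub_nonneg]

theorem coneM_exp_le {f g : ι → ℝ} {δ : ℝ} (h : ∀ i, f i - g i ≤ δ) :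
    coneM J.coneOfSquares (∑ i, Real.exp (f i) • c i) (∑ i, Real.exp (g i) • c i) ≤
      Real.exp δ := by
  refine csInf_le ⟨0, fun β hβ => hβ.1.le⟩ ⟨Real.exp_pos _, hc.coneLE_sum_iff.2 fun i => ?_⟩
  rw [← Real.exp_add]
  exact Real.exp_le_exp.2 (by linarith [h i])

theorem le_coneM_exp (f g : ι → ℝ) (i : ι) :
    Real.exp (f i - g i) ≤
      coneM J.coneOfSquares (∑ i, Real.exp (f i) • c i) (∑ i, Real.exp (g i) • c i) := by
  refine le_csInf
    (exists_coneLE (hc.sum_mem_symmetricCone_iff.2 fun i => Real.exp_pos _)) fun β hβ => ?_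
  rw [Real.exp_sub, div_le_iff₀ (Real.exp_pos _)]
  exact hc.coneLE_sum_iff.1 hβ.2 i

/-- In logarithmic coordinates, Thompson's metric is the supremum metric. -/
theorem thompsonDist_exp {f g : ι → ℝ} {δ : ℝ} (h : ∀ i, |f i - g i| ≤ δ)
    (h' : ∃ i, |f i - g i| = δ) :
    thompsonDist J.coneOfSquares (∑ i, Real.exp (f i) • c i) (∑ i, Real.exp (g i) • c i) =
      ENNReal.ofReal δ := by
  rw [thompsonDist_eq (hc.sum_mem_symmetricCone_iff.2 fun i => Real.exp_pos _)
    (hc.sum_mem_symmetricCone_iff.2 fun i => Real.exp_pos _)]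
  have h1 := hc.coneM_exp_le fun i => (abs_le.1 (h i)).2
  have h2 := hc.coneM_exp_le (f := g) (g := f) (δ := δ) fun i => by linarith [(abs_le.1 (h i)).1]
  rw [← Real.log_exp δ, le_antisymm (max_le h1 h2)]
  obtain ⟨i, hi⟩ := h'
  rcases abs_choice (f i - g i) with h3 | h3
  · exact le_max_of_le_left (by rw [← hi, h3]; exact hc.le_coneM_exp f g i)
  · refine le_max_of_le_right ?_
    rw [← hi, h3, neg_sub]
    exact hc.le_coneM_exp g f i

/-- A 1-Lipschitz coordinate that covers distance `r` in time `r` moves at unit speed throughout, so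
it realizes the sup distance at all times. -/
theorem isGeodesicSegment_exp {r : ℝ} (hr : 0 ≤ r) {g : ℝ → ι → ℝ}
    (hg : ∀ i s t, |g s i - g t i| ≤ |s - t|) (hg' : ∃ i, |g 0 i - g r i| = r) :
    IsGeodesicSegment (thompsonDist J.coneOfSquares) J.symmetricCone
      (∑ i, Real.exp (g 0 i) • c i) (∑ i, Real.exp (g r i) • c i)
      ((fun t => ∑ i, Real.exp (g t i) • c i) '' Set.Icc 0 r) := by
  refine ⟨0, r, _, hr, ⟨fun t _ => hc.sum_mem_symmetricCone_iff.2 fun i => Real.exp_pos _,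
    fun s hs t ht => hc.thompsonDist_exp (fun i => hg i s t) ?_⟩, rfl, rfl, rfl⟩
  obtain ⟨i, hi⟩ := hg'
  refine ⟨i, le_antisymm (hg i s t) ?_⟩
  have key : ∀ s ∈ Set.Icc 0 r, ∀ t ∈ Set.Icc 0 r, s ≤ t → |s - t| ≤ |g s i - g t i| := by
    intro s hs t ht hst
    have h1 := hg i 0 s
    have h2 := hg i t r
    have h3 := abs_sub_le (g 0 i) (g s i) (g r i)
    have h4 := abs_sub_le (g s i) (g t i) (g r i)
    rw [abs_of_nonpos (by linarith [hs.1] : 0 - s ≤ 0)] at h1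
    rw [abs_of_nonpos (by linarith [ht.2] : t - r ≤ 0)] at h2
    rw [abs_of_nonpos (by linarith : s - t ≤ 0)]
    linarith
  rcases le_total s t with hst | hst
  · exact key s hs t ht hst
  · rw [abs_sub_comm s, abs_sub_comm (g s i)]
    exact key t ht s hs hst

omit [FiniteDimensional ℝ V] in
theorem unit_eq_sum_exp : J.e = ∑ i, Real.exp ((fun _ => 0 : ι → ℝ) i) • c i := by
  simp [hc.complete]

/-- Each coordinate is the largest 1-Lipschitz function on `[0, r]` from `lᵢ` to `0`. -/
theorem isGeodesicSegment_upper {l : ι → ℝ} {r : ℝ} (hl : ∀ i, |l i| ≤ r)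
    (hl' : ∃ i, |l i| = r) :
    IsGeodesicSegment (thompsonDist J.coneOfSquares) J.symmetricCone
      (∑ i, Real.exp (l i) • c i) J.e
      ((fun t => ∑ i, Real.exp (min (l i + t) (r - t)) • c i) '' Set.Icc 0 r) := by
  have hr : 0 ≤ r := by obtain ⟨i, rfl⟩ := hl'; exact abs_nonneg _
  have h0 : ∀ i, min (l i + 0) (r - 0) = l i := fun i => by
    rw [add_zero, sub_zero, min_eq_left (abs_le.1 (hl i)).2]
  have h1 : ∀ i, min (l i + r) (r - r) = 0 := fun i => by
    rw [sub_self, min_eq_right (by linarith [(abs_le.1 (hl i)).1])]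
  have := hc.isGeodesicSegment_exp hr (g := fun t i => min (l i + t) (r - t)) (fun i s t => by
    refine (abs_min_sub_min_le_max _ _ _ _).trans (max_le ?_ ?_)
    · rw [add_sub_add_left_eq_sub]
    · rw [sub_sub_sub_cancel_left, abs_sub_comm]) (by simp only [h0, h1]; simpa using hl')
  rw [hc.unit_eq_sum_exp]
  simpa only [h0, h1] using this

theorem isGeodesicSegment_lower {l : ι → ℝ} {r : ℝ} (hl : ∀ i, |l i| ≤ r)
    (hl' : ∃ i, |l i| = r) :
    IsGeodesicSegment (thompsonDist J.coneOfSquares) J.symmetricCone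
      (∑ i, Real.exp (l i) • c i) J.e
      ((fun t => ∑ i, Real.exp (max (l i - t) (t - r)) • c i) '' Set.Icc 0 r) := by
  have hr : 0 ≤ r := by obtain ⟨i, rfl⟩ := hl'; exact abs_nonneg _
  have h0 : ∀ i, max (l i - 0) (0 - r) = l i := fun i => by
    rw [sub_zero, zero_sub, max_eq_left (abs_le.1 (hl i)).1]
  have h1 : ∀ i, max (l i - r) (r - r) = 0 := fun i => by
    rw [sub_self, max_eq_right (by linarith [(abs_le.1 (hl i)).2])]
  have := hc.isGeodesicSegment_exp hr (g := fun t i => max (l i - t) (t - r)) (fun i s t => by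
    refine (abs_max_sub_max_le_max _ _ _ _).trans (max_le ?_ ?_)
    · rw [sub_sub_sub_cancel_left, abs_sub_comm]
    · rw [sub_sub_sub_cancel_right]) (by simp only [h0, h1]; simpa using hl')
  rw [hc.unit_eq_sum_exp]
  simpa only [h0, h1] using this

omit [FiniteDimensional ℝ V] in
theorem abs_eq_of_upper_eq_lower {l : ι → ℝ} {r : ℝ} (hl : ∀ i, |l i| ≤ r)
    (hl' : ∃ i, |l i| = r)
    (h : (fun t => ∑ i, Real.exp (min (l i + t) (r - t)) • c i) '' Set.Icc 0 r ⊆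
      (fun t => ∑ i, Real.exp (max (l i - t) (t - r)) • c i) '' Set.Icc 0 r) (j : ι) :
    |l j| = r := by
  by_contra hne
  have hlt := abs_lt.1 (lt_of_le_of_ne (hl j) hne)
  -- The time at which the `j`-th upper coordinate peaks.
  obtain ⟨s, ⟨hs0, hs1⟩, hs⟩ := h ⟨(r - l j) / 2, ⟨by linarith, by linarith⟩, rfl⟩
  have heq : ∀ i, max (l i - s) (s - r) = min (l i + (r - l j) / 2) (r - (r - l j) / 2) :=
    fun i => Real.exp_injective (congrFun (hc.sum_injective hs) i)
  -- A coordinate with `|lᵢ| = r` is the same strictly monotone function on both paths, so the two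
  -- parameters agree.
  have hst : s = (r - l j) / 2 := by
    obtain ⟨i, hi⟩ := hl'
    have := heq i
    rcases eq_or_eq_neg_of_abs_eq hi with hi | hi
    · rw [hi, max_eq_left (by linarith), min_eq_right (by linarith)] at this
      linarith
    · rw [hi, max_eq_right (by linarith), min_eq_left (by linarith)] at this
      linarith
  have h2 := heq j
  rw [min_eq_left (by linarith)] at h2
  rcases max_choice (l j - s) (s - r) with h3 | h3 <;> rw [h3] at h2 <;> linarith

/-- Where `lᵢ = r`, `h1` and `h3` bound `⟨w, cᵢ⟩` by the same value from both sides; where `lᵢ =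
-r`, `h2` and `h4` do. Equality turns orthogonality to `cᵢ` into a vanishing product. -/
theorem eq_of_coneLE {l : ι → ℝ} {r s : ℝ} (hl : ∀ i, |l i| = r) (hs0 : 0 ≤ s) (hs1 : s ≤ r) {w : V}
    (h1 : ConeLE J.coneOfSquares (∑ i, Real.exp (l i) • c i) (Real.exp s • w))
    (h2 : ConeLE J.coneOfSquares w (Real.exp s • ∑ i, Real.exp (l i) • c i))
    (h3 : ConeLE J.coneOfSquares w (Real.exp (r - s) • J.e))
    (h4 : ConeLE J.coneOfSquares J.e (Real.exp (r - s) • w)) :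
    w = ∑ i, Real.exp (min (l i + s) (r - s)) • c i := by
  have hinn : ∀ {u : V}, u ∈ J.coneOfSquares → ∀ i, 0 ≤ inner ℝ u (c i) := fun hu i => by
    have := mem_coneOfSquares_iff_inner.1 hu (c i)
    rwa [inner_mul_self, hc.idempotent] at this
  have he : ∀ i, inner ℝ J.e (c i) = ‖c i‖ ^ 2 := fun i => by
    have := hc.inner_sum (fun _ => 1) i
    simpa only [one_smul, hc.complete, one_mul] using this
  have key : ∀ i, J.L w (c i) = Real.exp (min (l i + s) (r - s)) • c i := by
    intro i
    rcases eq_or_eq_neg_of_abs_eq (hl i) with hi | hi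
    · rw [min_eq_right (by linarith)]
      have e1 := hinn h1 i
      have e3 := hinn h3 i
      rw [inner_sub_left, real_inner_smul_left, hc.inner_sum, hi] at e1
      rw [inner_sub_left, real_inner_smul_left, he] at e3
      have e5 : inner ℝ (Real.exp (r - s) • J.e - w) (c i) = 0 := by
        rw [inner_sub_left, real_inner_smul_left, he]
        refine le_antisymm ?_ e3
        have : Real.exp r = Real.exp s * Real.exp (r - s) := by rw [← Real.exp_add]; congr 1; ring
        rw [this] at e1
        have e6 : 0 ≤ Real.exp s * (inner ℝ w (c i) - Real.exp (r - s) * ‖c i‖ ^ 2) := by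
          linarith
        linarith [nonneg_of_mul_nonneg_right e6 (Real.exp_pos s)]
      have e7 := mul_eq_zero_of_inner_eq_zero h3 (hc.idempotent i) e5
      rw [map_sub, map_smul, LinearMap.sub_apply, LinearMap.smul_apply, J.unit_mul] at e7
      exact (sub_eq_zero.1 e7).symm
    · rw [min_eq_left (by linarith)]
      have e2 := hinn h2 i
      have e4 := hinn h4 i
      rw [inner_sub_left, real_inner_smul_left, hc.inner_sum, hi, ← mul_assoc,
        ← Real.exp_add] at e2
      rw [inner_sub_left, real_inner_smul_left, he] at e4
      have hexp : Real.exp (r - s) * Real.exp (s + -r) = 1 := by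
        rw [← Real.exp_add, ← Real.exp_zero]; congr 1; ring
      have e5 : inner ℝ (Real.exp (r - s) • w - J.e) (c i) = 0 := by
        rw [inner_sub_left, real_inner_smul_left, he]
        refine le_antisymm ?_ e4
        have := mul_nonneg (Real.exp_pos (r - s)).le e2
        rw [mul_sub, ← mul_assoc, hexp] at this
        linarith
      have e7 := mul_eq_zero_of_inner_eq_zero h4 (hc.idempotent i) e5
      rw [map_sub, map_smul, LinearMap.sub_apply, LinearMap.smul_apply, J.unit_mul,
        sub_eq_zero] at e7
      rw [hi, add_comm]
      nth_rewrite 2 [← e7]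
      rw [smul_smul, _root_.mul_comm, hexp, one_smul]
  rw [← J.mul_unit w, ← hc.complete, map_sum]
  exact Finset.sum_congr rfl fun i _ => key i

theorem isGeodesicSegment_eq_upper [Nonempty ι] {l : ι → ℝ} {r : ℝ} (hl : ∀ i, |l i| = r)
    {S : Set V} (hS : IsGeodesicSegment (thompsonDist J.coneOfSquares) J.symmetricCone
      (∑ i, Real.exp (l i) • c i) J.e S) :
    S = (fun t => ∑ i, Real.exp (min (l i + t) (r - t)) • c i) '' Set.Icc 0 r := by
  obtain ⟨a, b, γ, hab, ⟨hγ, hd⟩, hγa, hγb, rfl⟩ := hS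
  have ha : a ∈ Set.Icc a b := ⟨le_rfl, hab⟩
  have hb : b ∈ Set.Icc a b := ⟨hab, le_rfl⟩
  have hr : 0 ≤ r := hl (Classical.arbitrary ι) ▸ abs_nonneg _
  have hbr : b - a = r := by
    have h1 := hd a ha b hb
    rw [hγa, hγb, hc.unit_eq_sum_exp, hc.thompsonDist_exp (δ := r) (fun i => by simp [hl i])
      ⟨Classical.arbitrary ι, by simp [hl]⟩, abs_sub_comm, abs_of_nonneg (by linarith)] at h1
    exact ((ENNReal.ofReal_eq_ofReal_iff hr (by linarith)).1 h1).symm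
  have key : ∀ t ∈ Set.Icc a b,
      γ t = ∑ i, Real.exp (min (l i + (t - a)) (r - (t - a))) • c i := by
    intro t ht
    have h1 := hd a ha t ht
    have h2 := hd t ht b hb
    rw [abs_sub_comm, abs_of_nonneg (sub_nonneg.2 ht.1)] at h1
    rw [abs_sub_comm, abs_of_nonneg (sub_nonneg.2 ht.2)] at h2
    have h3 := coneLE_of_thompsonDist_eq (hγ a ha) (hγ t ht) (sub_nonneg.2 ht.1) h1
    have h4 := coneLE_of_thompsonDist_eq (hγ t ht) (hγ b hb) (sub_nonneg.2 ht.2) h2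
    rw [hγa] at h3
    rw [hγb, show b - t = r - (t - a) by linarith] at h4
    exact hc.eq_of_coneLE hl (sub_nonneg.2 ht.1) (by linarith [ht.2]) h3.1 h3.2 h4.1 h4.2
  ext w
  constructor
  · rintro ⟨t, ht, rfl⟩
    exact ⟨t - a, ⟨by linarith [ht.1], by linarith [ht.2]⟩, (key t ht).symm⟩
  · rintro ⟨s, hs, rfl⟩
    have ht : a + s ∈ Set.Icc a b := ⟨by linarith [hs.1], by linarith [hs.2]⟩
    refine ⟨a + s, ht, ?_⟩
    rw [key _ ht, add_sub_cancel_left]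

end IsCompleteSystem

/-! ### Uniqueness of geodesics to the unit, and the theorem. -/

theorem existsUnique_geodesicSegment_unit_iff {z : V} (hz : z ∈ J.symmetricCone)
    (hze : ∀ t : ℝ, z ≠ t • J.e) :
    (∃! S, IsGeodesicSegment (thompsonDist J.coneOfSquares) J.symmetricCone z J.e S) ↔
      ∃ β : ℝ, 1 < β ∧ J.spec z = {β⁻¹, β} := by
  obtain ⟨⟨k, eig, c, -, h1, h2, h3, h4, h5⟩⟩ := J.nonempty_spectralDecomposition z
  have hc : J.IsCompleteSystem c := ⟨h1, h2, h3, h4⟩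
  subst h5
  have hpos := hc.sum_mem_symmetricCone_iff.1 hz
  obtain ⟨l, rfl⟩ : ∃ l : Fin k → ℝ, eig = fun i => Real.exp (l i) :=
    ⟨fun i => Real.log (eig i), funext fun i => (Real.exp_log (hpos i)).symm⟩
  rw [hc.spec_sum]
  have hne : Nonempty (Fin k) := by
    by_contra h
    rw [not_nonempty_iff] at h
    exact hze 0 (by simp)
  -- Applied at `r` and `-r`, this makes both signs occur.
  have hnc : ∀ t, ∃ i, l i ≠ t := by
    intro t
    by_contra! h
    refine hze (Real.exp t) ?_
    rw [← hc.complete, Finset.smul_sum]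
    exact Finset.sum_congr rfl fun i _ => by simp only [h i]
  constructor
  · rintro ⟨S, -, huniq⟩
    obtain ⟨m, hm⟩ := Finite.exists_max fun i => |l i|
    have hU := huniq _ (hc.isGeodesicSegment_upper hm ⟨m, rfl⟩)
    have hL := huniq _ (hc.isGeodesicSegment_lower hm ⟨m, rfl⟩)
    have habs := hc.abs_eq_of_upper_eq_lower hm ⟨m, rfl⟩ (hU.trans hL.symm).subset
    set r := |l m| with hr
    have hcases : ∀ i, l i = r ∨ l i = -r := fun i => eq_or_eq_neg_of_abs_eq (habs i)
    have hr0 : 0 < r := by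
      refine lt_of_le_of_ne (abs_nonneg _) fun h => ?_
      obtain ⟨i, hi⟩ := hnc 0
      have := habs i
      rw [← h, abs_eq_zero] at this
      exact hi this
    refine ⟨Real.exp r, Real.one_lt_exp_iff.2 hr0, ?_⟩
    rw [← Real.exp_neg]
    apply Set.Subset.antisymm
    · rintro _ ⟨i, rfl⟩
      rcases hcases i with h | h
      · exact Or.inr (by simp [h])
      · exact Or.inl (by simp [h])
    · rintro _ (rfl | rfl)
      · obtain ⟨i, hi⟩ := hnc r
        exact ⟨i, by simp only [(hcases i).resolve_left hi]⟩
      · obtain ⟨i, hi⟩ := hnc (-r)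
        exact ⟨i, by simp only [(hcases i).resolve_right hi]⟩
  · rintro ⟨β, hβ, hspec⟩
    have hβ0 : 0 < β := one_pos.trans hβ
    have habs : ∀ i, |l i| = Real.log β := by
      intro i
      have hlog := Real.log_pos hβ
      have : Real.exp (l i) ∈ ({β⁻¹, β} : Set ℝ) := hspec ▸ ⟨i, rfl⟩
      rcases this with h | h
      · rw [← Real.log_exp (l i), h, Real.log_inv, abs_neg, abs_of_pos hlog]
      · rw [← Real.log_exp (l i), Set.mem_singleton_iff.1 h, abs_of_pos hlog]
    exact ⟨_, hc.isGeodesicSegment_upper (fun i => (habs i).le) ⟨Classical.arbitrary _, habs _⟩,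
      fun S hS => hc.isGeodesicSegment_eq_upper habs hS⟩

end EuclideanJordanAlgebra

theorem theorem6p2 {V : Type*} [NormedAddCommGroup V] [InnerProductSpace ℝ V]
    [FiniteDimensional ℝ V] (J : EuclideanJordanAlgebra V) (x y : V)
    (hx : x ∈ J.symmetricCone) (hy : y ∈ J.symmetricCone)
    (hxy : LinearIndependent ℝ ![x, y]) :
    (∃! S : Set V,
        IsGeodesicSegment (thompsonDist J.coneOfSquares) J.symmetricCone x y S) ↔
      ∃ β : ℝ, 1 < β ∧ J.spec (J.P (J.invSqrt y) x) = {β⁻¹, β} := by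
  obtain ⟨T, hTP, hTK, hTy⟩ := EuclideanJordanAlgebra.exists_P_invSqrt_equiv hy
  have hTo := EuclideanJordanAlgebra.map_mem_symmetricCone_iff T hTK
  rw [← existsUnique_geodesicSegment_map x y T hTo
    (thompsonDist_map T hTK), hTy, ← hTP]
  refine EuclideanJordanAlgebra.existsUnique_geodesicSegment_unit_iff ((hTo x).2 hx) fun t ht => ?_
  have h1 : x = t • y := T.injective (by rw [ht, map_smul, hTy])
  have h2 := LinearIndependent.pair_iff.1 hxy 1 (-t) (by rw [h1]; module)
  exact one_ne_zero h2.1
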